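/- Let $V$ be a closed isometric operator in a Hilbert space $H$, that is, a closed linear operator with domain a linear subspace $D(V)\subseteq H$ (not necessarily dense) such that $\|Vf\|=\|f\|$ for $f\in D(V)$; let $R(V)$ be its range and $E_H$ the identity operator of $H$. Put $\mathbb D=\{|z|<1\}$, $\mathbb D_e=\{|z|>1\}$, $\mathbb T=\{|z|=1\}$, and $$M_\zeta=(E_H-\zeta V)D(V),\quad N_\zeta=H\ominus M_\zeta\quad(\zeta\in\mathbb C),\qquad M_\infty=R(V),\quad N_\infty=H\ominus R(V),$$ so that $M_0=D(V)$ and $N_0=H\ominus D(V)$. For a subspace $L$ of $H$, $P_L$ denotes the orthogonal projection of $H$ onto $L$. A number $\mu$ is a point of the regular type of $V$ if $V-\mu E_H$ has a bounded inverse defined on $(V-\mu E_H)D(V)$. For $\zeta\in\mathbb T$ let $W_\zeta$ be the (well-defined, isometric) operator with domain $P_{N_0}N_\zeta$ and values in $N_\infty$ given by $$W_\zeta P_{N_0}f=\zeta^{-1}P_{N_\infty}f,\qquad f\in N_\zeta .$$ A generalized resolvent of $V$ is a function $\mathbf R_z h=P_H(E_{\widetilde H}-zU)^{-1}h$, $h\in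 H$, $z\in\mathbb D\cup\mathbb D_e$, where $U\supseteq V$ is a unitary operator in a Hilbert space $\widetilde H\supseteq H$ and $P_H$ is the orthogonal projection of $\widetilde H$ onto $H$. Let $\Delta$ be an open arc of $\mathbb T$ such that, for every $\zeta\in\Delta$, $\zeta^{-1}$ is a point of the regular type of $V$ and $$P_{M_\infty}M_\zeta=M_\infty .$$ Let $\mathbf R_z$ be an arbitrary generalized resolvent of $V$, and let $C(\lambda)=C(\lambda;0)$, $\lambda\in\mathbb D$, be the analytic function, whose values are linear contractions from $N_0$ into $N_\infty$, that corresponds to it by $$\mathbf R_\lambda=\left[E_H-\lambda\,(V\oplus C(\lambda;0))\right]^{-1},\qquad \lambda\in\mathbb D .$$ Then $\mathbf R_z$ has an analytic continuation to $\mathbb D\cup\mathbb D_e\cup\Delta$ if and only if the following conditions are satisfied: 1) $C(\lambda;0)$ has an extension to $\mathbb D\cup\Delta$ which is continuous in the uniform operator topology; 2) for all $\lambda\in\Delta$ the extended $C(\lambda;0)$ maps $N_0$ isometrically onto the whole of $N_\infty$; 3) for all $\lambda\in\Delta$ the operator $C(\lambda;0)-W_\lambda$ is invertible (that is, injective), and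 $(C(\lambda;0)-W_\lambda)N_0=N_\infty$. -/

import Mathlib

noncomputable section

/-- A closed isometric operator `V` in `H`: a closed linear operator, defined on a linear subspace
`D(V)` of `H` (not assumed dense), that preserves the norm. -/
structure ClosedIsometry (H : Type*) [NormedAddCommGroup H] [InnerProductSpace ℂ H]
    extends H →ₗ.[ℂ] H where
  closed : toLinearPMap.IsClosed
  isometric : ∀ x : domain, ‖toFun x‖ = ‖x‖

namespace ClosedIsometry

section

variable {H : Type*} [NormedAddCommGroup H] [InnerProductSpace ℂ H] [CompleteSpace H]
variable (V : ClosedIsometry H)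

/-- `V` as a linear isometry from `D(V)` into `H`. -/
def toIsometry : V.domain →ₗᵢ[ℂ] H where
  toLinearMap := V.toFun
  norm_map' := V.isometric

/-- The range `M_ζ = (E - ζ V) D(V)`. -/
def M (ζ : ℂ) : Submodule ℂ H := LinearMap.range (V.domain.subtype - ζ • V.toFun)

/-- The defect subspace `N_ζ = H ⊖ M_ζ`. -/
def N (ζ : ℂ) : Submodule ℂ H := (V.M ζ)ᗮ

/-- `M_∞ = R(V)`. -/
def Minf : Submodule ℂ H := LinearMap.range V.toFun

/-- `N_∞ = H ⊖ R(V)`. -/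
def Ninf : Submodule ℂ H := V.Minfᗮ

theorem isClosed_domain : IsClosed (V.domain : Set H) := by
  apply IsSeqClosed.isClosed
  intro x a hx hxa
  have hc : CauchySeq (fun n => V.toIsometry ⟨x n, hx n⟩) := by
    have h1 : CauchySeq (fun n => (⟨x n, hx n⟩ : V.domain)) :=
      V.domain.subtypeₗᵢ.isometry.isUniformInducing.cauchy_map_iff.1 (by
        rw [Filter.map_map]; exact hxa.cauchySeq)
    exact V.toIsometry.isometry.uniformContinuous.comp_cauchySeq h1
  obtain ⟨b, hb⟩ := cauchySeq_tendsto_of_complete hc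
  have hmem : (a, b) ∈ V.graph := by
    have hcl : IsClosed (V.graph : Set (H × H)) := V.closed
    refine hcl.mem_of_tendsto (hxa.prodMk_nhds hb) (Filter.Eventually.of_forall fun n => ?_)
    exact V.mem_graph ⟨x n, hx n⟩
  obtain ⟨y, hy, -⟩ := (LinearPMap.mem_graph_iff _).1 hmem
  have ha : (y : H) = a := hy
  exact ha ▸ y.2

instance : CompleteSpace V.domain := V.isClosed_domain.completeSpace_coe

instance : CompleteSpace V.Minf :=
  (V.toIsometry.isometry.isUniformInducing.isComplete_range).completeSpace_coe

instance (ζ : ℂ) : (V.N ζ).HasOrthogonalProjection :=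
  inferInstanceAs ((V.M ζ)ᗮ).HasOrthogonalProjection

instance : V.Ninf.HasOrthogonalProjection :=
  inferInstanceAs (V.Minfᗮ).HasOrthogonalProjection

/-- `μ` is a point of the regular type of `V`: the operator `V - μ E` has a bounded inverse,
defined on its range. -/
def IsRegularTypePoint (μ : ℂ) : Prop :=
  ∃ c : ℝ, 0 < c ∧ ∀ x : V.domain, c * ‖x‖ ≤ ‖V.toFun x - μ • (x : H)‖

/-- The orthogonal sum `V ⊕ C`, which acts on `H = D(V) ⊕ N_0` as `V` on `D(V)` and as `C` on
`N_0 = H ⊖ D(V)`. -/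
def oplus (C : V.N 0 →L[ℂ] V.Ninf) : H →L[ℂ] H :=
  V.toIsometry.toContinuousLinearMap ∘L V.domain.orthogonalProjectionOnto +
    V.Ninf.subtypeL ∘L C ∘L (V.N 0).orthogonalProjectionOnto

/-- The graph of `W_ζ`: all pairs `(P_{N_0} f, ζ⁻¹ P_{N_∞} f)` with `f ∈ N_ζ`. -/
def graphW (ζ : ℂ) : Submodule ℂ (V.N 0 × V.Ninf) :=
  (V.N ζ).map (((V.N 0).orthogonalProjectionOnto : H →ₗ[ℂ] V.N 0).prod
    (ζ⁻¹ • (V.Ninf.orthogonalProjectionOnto : H →ₗ[ℂ] V.Ninf)))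

/-- The operator `W_ζ` with domain `P_{N_0} N_ζ`, given by
`W_ζ P_{N_0} f = ζ⁻¹ P_{N_∞} f` for `f ∈ N_ζ`. -/
def W (ζ : ℂ) : V.N 0 →ₗ.[ℂ] V.Ninf := (V.graphW ζ).toLinearPMap

/-- For `|ζ| = 1`, the relation that defines `W_ζ` is single-valued. -/
theorem graph_W {ζ : ℂ} (hζ : ‖ζ‖ = 1) : (V.W ζ).graph = V.graphW ζ := by
  apply Submodule.toLinearPMap_graph_eq
  rintro _ ⟨f, hf, rfl⟩ h0
  have h1 : f ∈ V.domain := by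
    have : f ∈ (V.N 0)ᗮ := by
      rw [← Submodule.orthogonalProjectionOnto_eq_zero_iff]; exact h0
    rwa [N, show V.M 0 = V.domain by simp [M], Submodule.orthogonal_orthogonal] at this
  have h2 : inner ℂ (f - ζ • V.toFun ⟨f, h1⟩) f = 0 := hf _ ⟨⟨f, h1⟩, by simp⟩
  have h3 : f = ζ • V.toFun ⟨f, h1⟩ := by
    have hn : ‖V.toFun ⟨f, h1⟩‖ = ‖f‖ := V.isometric ⟨f, h1⟩
    set v := ζ • V.toFun ⟨f, h1⟩ with hv
    have hvn : ‖v‖ = ‖f‖ := by rw [hv, norm_smul, hζ, one_mul, hn]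
    rw [inner_sub_left, sub_eq_zero] at h2
    have h4 := @norm_sub_sq ℂ _ _ _ _ v f
    rw [← h2, inner_self_eq_norm_sq_to_K, hvn] at h4
    norm_cast at h4
    have h5 : ‖v - f‖ ^ 2 = 0 := by
      rw [h4]; ring
    have h6 : v - f = 0 := by simpa using h5
    exact (sub_eq_zero.1 h6).symm
  have h7 : f ∈ V.Ninfᗮ := by
    rw [Ninf, Submodule.orthogonal_orthogonal, h3]
    exact Submodule.smul_mem _ _ ⟨_, rfl⟩
  have h8 := Submodule.orthogonalProjectionOnto_eq_zero_iff.2 h7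
  simp [h8]

/-- `R` is a generalized resolvent of `V`: for some unitary operator `U ⊇ V` in a Hilbert space
`K ⊇ H`, one has `R_z h = P_H (E - z U)⁻¹ h` for `h ∈ H` and `|z| ≠ 1`. The inclusion of `H` into
`K` is an isometric embedding `J`, and the projection of `K` onto `H` is then its adjoint. The
values `R z` with `|z| = 1` play no role. -/
def IsGeneralizedResolvent.{v} (R : ℂ → H →L[ℂ] H) : Prop :=
  ∃ (K : Type v) (_ : NormedAddCommGroup K) (_ : InnerProductSpace ℂ K) (_ : CompleteSpace K)
    (J : H →ₗᵢ[ℂ] K) (U : K ≃ₗᵢ[ℂ] K),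
    (∀ x : V.domain, U (J x) = J (V.toFun x)) ∧
    ∀ z : ℂ, ‖z‖ ≠ 1 →
      R z = J.toContinuousLinearMap.adjoint ∘L
        Ring.inverse (1 - z • ((U : K ≃L[ℂ] K) : K →L[ℂ] K)) ∘L J.toContinuousLinearMap

/-- The formula `R_z = [E - z (V ⊕ C(z))]⁻¹`, `|z| < 1`, by which the parameter
`C(z) = C(z; 0)` corresponds to `R`. -/
def Corresponds (R : ℂ → H →L[ℂ] H) (C : ℂ → V.N 0 →L[ℂ] V.Ninf) : Prop :=
  ∀ z ∈ Metric.ball (0 : ℂ) 1, R z = Ring.inverse (1 - z • V.oplus (C z))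

end

end ClosedIsometry

/-- The class `S(H₁; H₂)` of analytic functions in the open unit disc whose values are linear
contractions from `H₁` into `H₂`. -/
def schurClass (H₁ H₂ : Type*) [NormedAddCommGroup H₁] [NormedSpace ℂ H₁]
    [NormedAddCommGroup H₂] [NormedSpace ℂ H₂] : Set (ℂ → H₁ →L[ℂ] H₂) :=
  {C | AnalyticOnNhd ℂ C (Metric.ball 0 1) ∧ ∀ z ∈ Metric.ball (0 : ℂ) 1, ‖C z‖ ≤ 1}

/-- `Δ` is an open arc of the unit circle (possibly the whole circle). -/
def IsOpenArc (Δ : Set ℂ) : Prop :=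
  ∃ a b : ℝ, a < b ∧ Δ = (fun θ : ℝ => Complex.exp (θ * Complex.I)) '' Set.Ioo a b

end

/-!
A generalized resolvent satisfies `R_{1/z̄} = 1 - R_z*`, so a continuous extension of it to an
arc of the circle satisfies `R_ζ + R_ζ* = 1` there. Hence `R_ζ` is invertible and
`T_ζ = ζ⁻¹ (1 - R_ζ⁻¹)` is unitary; as the limit of `V ⊕ C(λ)` it has the form `V ⊕ C(ζ)`, which is
unitary exactly when `C(ζ)` maps `N_0` isometrically onto `N_∞`. Conversely, if `V ⊕ C(ζ)` is
unitary and `1 - ζ (V ⊕ C(ζ))` is invertible on the arc, the inverse extends `R` continuously from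
inside the disc, the symmetry carries this over to the outside, and Painlevé's theorem gives
analyticity across the arc.

Under the assumption on `M_ζ` one has the direct decompositions `H = D(V) ∔ N_ζ` and
`H = M_ζ ∔ N_∞`, for which `1 - ζ (V ⊕ C)` is block diagonal. Its block `D(V) → M_ζ` is always
bijective, and its block `N_ζ → N_∞` is `-ζ (C - W_ζ)` up to the identification of `N_ζ` with
`P_{N_0} N_ζ`; this turns invertibility into the condition on `C - W_ζ`.
-/

section Painleve

open Complex Set Metric Filter Topology
open scoped Interval

variable {E : Type*} [NormedAddCommGroup E] [NormedSpace ℂ E]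

theorem wedgeIntegral_add_wedgeIntegral_eq_split {f : ℂ → E} {z w : ℂ} {t : ℝ}
    (hf : ContinuousOn f (Rectangle z w)) (ht : t ∈ [[z.im, w.im]]) :
    wedgeIntegral z w f + wedgeIntegral w z f =
      (wedgeIntegral z ⟨w.re, t⟩ f + wedgeIntegral ⟨w.re, t⟩ z f) +
        (wedgeIntegral ⟨z.re, t⟩ w f + wedgeIntegral w ⟨z.re, t⟩ f) := by
  have hint {u a b : ℝ} (hu : u ∈ [[z.re, w.re]]) (ha : a ∈ [[z.im, w.im]])
      (hb : b ∈ [[z.im, w.im]]) :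
      IntervalIntegrable (fun y : ℝ => f (u + y * I)) MeasureTheory.volume a b := by
    refine (hf.comp (by fun_prop) fun y hy => ?_).intervalIntegrable
    exact ⟨by simpa using hu, by simpa using uIcc_subset_uIcc ha hb hy⟩
  have hvert {u : ℝ} (hu : u ∈ [[z.re, w.re]]) := intervalIntegral.integral_add_adjacent_intervals
    (hint hu left_mem_uIcc ht) (hint hu ht right_mem_uIcc)
  simp only [wedgeIntegral_add_wedgeIntegral_eq, ← hvert left_mem_uIcc, ← hvert right_mem_uIcc,
    smul_add]
  abel

theorem wedgeIntegral_add_wedgeIntegral_eq_zero {f : ℂ → E} {z w : ℂ}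
    (hf : ContinuousOn f (Rectangle z w))
    (hd : ∀ x ∈ Rectangle z w, x.im ≠ 0 → DifferentiableAt ℂ f x)
    (h0 : (0 : ℝ) ∉ Ioo (min z.im w.im) (max z.im w.im)) :
    wedgeIntegral z w f + wedgeIntegral w z f = 0 := by
  rw [wedgeIntegral_add_wedgeIntegral_eq]
  refine integral_boundary_rect_eq_zero_of_continuousOn_of_differentiableOn f z w hf ?_
  intro x hx
  have him : x.im ≠ 0 := fun h => h0 (h ▸ hx.2)
  exact (hd x ⟨Ioo_subset_Icc_self hx.1, Ioo_subset_Icc_self hx.2⟩ him).differentiableWithinAt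

theorem isConservativeOn_of_differentiableAt_off_real {f : ℂ → E} {U : Set ℂ}
    (hf : ContinuousOn f U) (hd : ∀ z ∈ U, z.im ≠ 0 → DifferentiableAt ℂ f z) :
    IsConservativeOn f U := by
  intro z w hzw
  rw [← add_eq_zero_iff_eq_neg]
  by_cases h0 : (0 : ℝ) ∈ [[z.im, w.im]]
  · have hlower : Rectangle z ⟨w.re, 0⟩ ⊆ U := fun x hx =>
      hzw ⟨hx.1, uIcc_subset_uIcc left_mem_uIcc h0 hx.2⟩
    have hupper : Rectangle ⟨z.re, 0⟩ w ⊆ U := fun x hx =>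
      hzw ⟨hx.1, uIcc_subset_uIcc h0 right_mem_uIcc hx.2⟩
    rw [wedgeIntegral_add_wedgeIntegral_eq_split (hf.mono hzw) h0,
      wedgeIntegral_add_wedgeIntegral_eq_zero (hf.mono hlower) (fun x hx => hd x (hlower hx))
        (by simpa using le_of_lt),
      wedgeIntegral_add_wedgeIntegral_eq_zero (hf.mono hupper) (fun x hx => hd x (hupper hx))
        (by simpa using le_of_lt), add_zero]
  · exact wedgeIntegral_add_wedgeIntegral_eq_zero (hf.mono hzw) (fun x hx => hd x (hzw hx))
      fun h => h0 (Ioo_subset_Icc_self h)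

variable [CompleteSpace E]

theorem differentiableOn_of_differentiableAt_off_real {f : ℂ → E} {U : Set ℂ} (hU : IsOpen U)
    (hf : ContinuousOn f U) (hd : ∀ z ∈ U, z.im ≠ 0 → DifferentiableAt ℂ f z) :
    DifferentiableOn ℂ f U :=
  (isConservativeOn_and_continuousOn_iff_isDifferentiableOn hU).1
    ⟨isConservativeOn_of_differentiableAt_off_real hf hd, hf⟩

theorem norm_exp_mul_I_eq_exp_neg_im (w : ℂ) : ‖exp (w * I)‖ = Real.exp (-w.im) := by
  simp [norm_exp]

theorem analyticOnNhd_of_differentiableAt_off_circle {f : ℂ → E} {U : Set ℂ} (hU : IsOpen U)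
    (hf : ContinuousOn f U) (hd : ∀ z ∈ U, ‖z‖ ≠ 1 → DifferentiableAt ℂ f z) :
    AnalyticOnNhd ℂ f U := by
  intro z hz
  by_cases hz1 : ‖z‖ = 1
  · obtain ⟨θ, rfl⟩ := (norm_eq_one_iff z).1 hz1
    have hexp : Differentiable ℂ fun w : ℂ => exp (w * I) := by fun_prop
    have hderiv : deriv (fun w : ℂ => exp (w * I)) θ ≠ 0 := by simp [deriv_cexp]
    have hcomp : DifferentiableOn ℂ (f ∘ fun w : ℂ => exp (w * I)) ((exp <| · * I) ⁻¹' U) := by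
      refine differentiableOn_of_differentiableAt_off_real (hU.preimage hexp.continuous)
        (hf.comp hexp.continuous.continuousOn (mapsTo_preimage _ _)) fun w hw him => ?_
      refine (hd _ hw ?_).comp w (hexp w)
      simpa [norm_exp_mul_I_eq_exp_neg_im] using him
    exact (analyticAt_comp_iff_of_deriv_ne_zero (hexp.analyticAt _) hderiv).1
      (hcomp.analyticAt ((hU.preimage hexp.continuous).mem_nhds hz))
  · have hopen : IsOpen (U ∩ {z | ‖z‖ ≠ 1}) := hU.inter (isOpen_ne_fun (by fun_prop) (by fun_prop))
    exact DifferentiableOn.analyticAt (fun w hw => (hd w hw.1 hw.2).differentiableWithinAt)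
      (hopen.mem_nhds ⟨hz, hz1⟩)

theorem analyticOnNhd_of_continuousOn_sides {f : ℂ → E} {Δ : Set ℂ}
    (hΔ : IsOpen ({z : ℂ | ‖z‖ < 1 ∨ 1 < ‖z‖} ∪ Δ))
    (hd : ∀ z, ‖z‖ ≠ 1 → DifferentiableAt ℂ f z)
    (hin : ContinuousOn f (ball 0 1 ∪ Δ)) (hout : ContinuousOn f ({z | 1 < ‖z‖} ∪ Δ)) :
    AnalyticOnNhd ℂ f ({z | ‖z‖ < 1 ∨ 1 < ‖z‖} ∪ Δ) := by
  refine analyticOnNhd_of_differentiableAt_off_circle hΔ ?_ fun z _ => hd z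
  rintro z (hz | hz)
  · exact (hd z (ne_iff_lt_or_gt.2 hz)).continuousAt.continuousWithinAt
  · refine ((hin z (.inr hz)).union (hout z (.inr hz))).mono ?_
    rintro w ((hw | hw) | hw)
    · exact .inl (.inl (mem_ball_zero_iff.2 hw))
    · exact .inr (.inl hw)
    · exact .inl (.inr hw)

end Painleve

namespace IsOpenArc

open Complex Set Metric

variable {Δ : Set ℂ}

theorem subset_sphere (hΔ : IsOpenArc Δ) : Δ ⊆ sphere 0 1 := by
  obtain ⟨a, b, -, rfl⟩ := hΔ
  rintro _ ⟨θ, -, rfl⟩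
  simp [norm_exp_ofReal_mul_I]

theorem isOpen_union (hΔ : IsOpenArc Δ) : IsOpen ({z : ℂ | ‖z‖ < 1 ∨ 1 < ‖z‖} ∪ Δ) := by
  obtain ⟨a, b, -, rfl⟩ := hΔ
  have hoff : IsOpen {z : ℂ | ‖z‖ < 1 ∨ 1 < ‖z‖} :=
    (isOpen_lt continuous_norm continuous_const).union (isOpen_lt continuous_const continuous_norm)
  have hsector : IsOpen ((fun w : ℂ => exp (w * I)) '' (re ⁻¹' Ioo a b)) :=
    (isOpenMap_exp.comp (Homeomorph.mulRight₀ I I_ne_zero).isOpenMap) _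
      (isOpen_Ioo.preimage continuous_re)
  convert hoff.union hsector using 1
  refine Subset.antisymm (union_subset_union_right _ ?_) (union_subset subset_union_left ?_)
  · rintro _ ⟨θ, hθ, rfl⟩
    exact ⟨θ, by simpa using hθ, rfl⟩
  · rintro _ ⟨w, hw, rfl⟩
    by_cases him : w.im = 0
    · exact .inr ⟨w.re, hw, by simp [Complex.ext_iff, him, exp_re, exp_im]⟩
    · refine .inl (lt_or_gt_of_ne ?_)
      simpa [norm_exp_mul_I_eq_exp_neg_im] using him

end IsOpenArc

section Topology

open Filter Topology Metric Set

theorem inv_star_eq_self {z : ℂ} (hz : ‖z‖ = 1) : (star z)⁻¹ = z := by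
  rw [Complex.star_def, ← Complex.inv_eq_conj hz, inv_inv]

theorem neBot_nhdsWithin_ball {E : Type*} [SeminormedAddCommGroup E] [NormedSpace ℝ E] {c x : E}
    {r : ℝ} (hr : r ≠ 0) (hx : x ∈ closedBall c r) : (𝓝[ball c r] x).NeBot := by
  rwa [← mem_closure_iff_nhdsWithin_neBot, closure_ball _ hr]

theorem continuousOn_piecewise_of_eventuallyEq {X Y : Type*} [TopologicalSpace X]
    [TopologicalSpace Y] {s t : Set X} [∀ x, Decidable (x ∈ s)] {f g : X → Y} (hs : IsOpen s)
    (hst : Disjoint s t) (hf : ContinuousOn f s) (hg : ∀ x ∈ t, ContinuousAt g x)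
    (hfg : ∀ x ∈ t, f =ᶠ[𝓝[s] x] g) : ContinuousOn (s.piecewise f g) (s ∪ t) := by
  have heqt : EqOn (s.piecewise f g) g t :=
    (piecewise_eqOn_compl s f g).mono hst.subset_compl_left
  rintro x (hx | hx)
  · refine ((hf.continuousAt (hs.mem_nhds hx)).congr ?_).continuousWithinAt
    exact ((piecewise_eqOn s f g).eventuallyEq_of_mem (hs.mem_nhds hx)).symm
  · refine (hg x hx).continuousWithinAt.congr_of_eventuallyEq ?_ (heqt hx)
    rw [EventuallyEq, nhdsWithin_union, eventually_sup]
    exact ⟨((piecewise_eqOn s f g).eventuallyEq_of_mem self_mem_nhdsWithin).trans (hfg x hx),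
      heqt.eventuallyEq_of_mem self_mem_nhdsWithin⟩

theorem continuousOn_exterior_of_symm {A : Type*} [TopologicalSpace A] [Ring A] [StarRing A]
    [IsTopologicalRing A] [ContinuousStar A] {f : ℂ → A} {Δ : Set ℂ} (hΔ : Δ ⊆ sphere 0 1)
    (hf : ContinuousOn f (ball 0 1 ∪ Δ))
    (hsymm : ∀ z ∈ {z : ℂ | 1 < ‖z‖} ∪ Δ, star (f (star z)⁻¹) + f z = 1) :
    ContinuousOn f ({z | 1 < ‖z‖} ∪ Δ) := by
  have hne : ∀ z ∈ {z : ℂ | 1 < ‖z‖} ∪ Δ, star z ≠ 0 := by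
    rintro z (hz | hz) <;> refine star_ne_zero.2 (norm_pos_iff.1 ?_)
    · exact one_pos.trans hz
    · exact (mem_sphere_zero_iff_norm.1 (hΔ hz)).symm ▸ one_pos
  have hmaps : MapsTo (fun z : ℂ => (star z)⁻¹) ({z | 1 < ‖z‖} ∪ Δ) (ball 0 1 ∪ Δ) := by
    rintro z (hz | hz)
    · refine .inl (mem_ball_zero_iff.2 ?_)
      rw [norm_inv, norm_star]
      exact inv_lt_one_of_one_lt₀ hz
    · exact .inr (by simpa only [inv_star_eq_self (mem_sphere_zero_iff_norm.1 (hΔ hz))] using hz)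
  refine (continuousOn_const (c := 1) |>.sub
    (hf.comp (continuous_star.continuousOn.inv₀ hne) hmaps).star).congr fun z hz => ?_
  exact eq_sub_of_add_eq' (hsymm z hz)

end Topology

section Ring

variable {A : Type*} [Ring A]

theorem ringInverse_one_sub_add_ringInverse_one_sub {a b : A} (hab : b * a = 1)
    (ha : IsUnit (1 - a)) (hb : IsUnit (1 - b)) :
    Ring.inverse (1 - b) + Ring.inverse (1 - a) = 1 := by
  have hsum : (1 - b) + (1 - a) = (1 - b) * (1 - a) := by
    simp only [mul_sub, sub_mul, one_mul, mul_one, hab]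
    abel
  rw [Ring.inverse_add_inverse (by simp only [ha, hb]), hsum, Ring.inverse_mul_cancel_left _ _ hb,
    Ring.mul_inverse_cancel _ ha]

theorem one_sub_ringInverse_mul_one_sub_ringInverse {x y : A} (hxy : x + y = 1) (hx : IsUnit x)
    (hy : IsUnit y) : (1 - Ring.inverse x) * (1 - Ring.inverse y) = 1 := by
  have hsum : Ring.inverse x + Ring.inverse y = Ring.inverse x * Ring.inverse y := by
    rw [Ring.inverse_add_inverse (by simp only [hx, hy]), hxy, mul_one]
  simp only [mul_sub, sub_mul, one_mul, mul_one, ← hsum]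
  abel

variable [StarRing A]

theorem one_sub_ringInverse_mem_unitary {x : A} (hx : IsUnit x) (hadd : x + star x = 1) :
    1 - Ring.inverse x ∈ unitary A := by
  rw [Unitary.mem_iff, star_sub, star_one, ← Ring.inverse_star]
  exact ⟨one_sub_ringInverse_mul_one_sub_ringInverse (by rw [add_comm, hadd]) hx.star hx,
    one_sub_ringInverse_mul_one_sub_ringInverse hadd hx hx.star⟩

end Ring

section Unitary

variable {𝕜 A : Type*} [Field 𝕜] [StarRing 𝕜] [Ring A] [StarRing A] [Algebra 𝕜 A]
  [StarModule 𝕜 A] {u : A} {z : 𝕜}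

theorem star_ringInverse_one_sub_smul_add (hu : u ∈ unitary A) (hz : z ≠ 0)
    (hunit : IsUnit (1 - z • u)) :
    star (Ring.inverse (1 - z • u)) + Ring.inverse (1 - (star z)⁻¹ • u) = 1 := by
  have hz' : star z ≠ 0 := star_ne_zero.2 hz
  have hstar : star (1 - z • u) = 1 - star z • star u := by simp
  have hfactor : 1 - (star z)⁻¹ • u = -((star z)⁻¹ • u) * star (1 - z • u) := by
    rw [sub_eq_neg_add]
    simp [hstar, mul_sub, smul_smul, hz', Unitary.mul_star_self_of_mem hu]
  have hreflect : IsUnit (1 - (star z)⁻¹ • u) := by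
    rw [hfactor]
    refine IsUnit.mul (IsUnit.neg ?_) hunit.star
    exact (Unitary.toUnits ⟨u, hu⟩).isUnit.smul (Units.mk0 _ (inv_ne_zero hz'))
  rw [← Ring.inverse_star, hstar]
  refine ringInverse_one_sub_add_ringInverse_one_sub ?_ hreflect (hstar ▸ hunit.star)
  simp [smul_smul, hz', Unitary.star_mul_self_of_mem hu]

end Unitary

/-- The operator `T` determined by its resolvent `X = (1 - z T)⁻¹` at the point `z ≠ 0`. -/
noncomputable def operatorOfResolvent {A : Type*} [Ring A] [Algebra ℂ A] (z : ℂ) (X : A) : A :=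
  z⁻¹ • (1 - Ring.inverse X)

section OperatorOfResolvent

variable {A : Type*} {z : ℂ}

section Algebra

variable [Ring A] [Algebra ℂ A]

theorem one_sub_smul_operatorOfResolvent (hz : z ≠ 0) (X : A) :
    1 - z • operatorOfResolvent z X = Ring.inverse X := by
  rw [operatorOfResolvent, smul_inv_smul₀ hz, sub_sub_cancel]

theorem operatorOfResolvent_ringInverse (hz : z ≠ 0) {T : A} (hT : IsUnit (1 - z • T)) :
    operatorOfResolvent z (Ring.inverse (1 - z • T)) = T := by
  rw [operatorOfResolvent, Ring.inverse_inverse hT, sub_sub_cancel, inv_smul_smul₀ hz]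

theorem operatorOfResolvent_mem_unitary [StarRing A] [StarModule ℂ A] (hz : ‖z‖ = 1) {X : A}
    (hX : IsUnit X) (hadd : X + star X = 1) : operatorOfResolvent z X ∈ unitary A := by
  refine Unitary.smul_mem_of_mem ?_ (one_sub_ringInverse_mem_unitary hX hadd)
  rw [Unitary.mem_iff_star_mul_self, Complex.star_def, Complex.conj_mul', norm_inv, hz]
  simp

end Algebra

theorem continuousAt_operatorOfResolvent [NormedRing A] [NormedAlgebra ℂ A]
    [HasSummableGeomSeries A] (hz : z ≠ 0) {X : A} (hX : IsUnit X) :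
    ContinuousAt (fun p : ℂ × A => operatorOfResolvent p.1 p.2) (z, X) := by
  have hinverse : ContinuousAt Ring.inverse X := NormedRing.inverse_continuousAt hX.unit
  exact (continuousAt_fst.inv₀ hz).smul
    (continuousAt_const.sub (hinverse.comp_of_eq continuousAt_snd rfl))

end OperatorOfResolvent

section Operator

theorem isUnit_one_sub_smul_of_mem_unitary {A : Type*} [CStarAlgebra A] {u : A} {z : ℂ}
    (hu : u ∈ unitary A) (hz : ‖z‖ ≠ 1) : IsUnit (1 - z • u) := by
  rcases eq_or_ne z 0 with rfl | hz0
  · simp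
  have hres : IsUnit (algebraMap ℂ A z⁻¹ - u) := by
    refine spectrum.notMem_iff.1 fun h => hz ?_
    simpa using spectrum.subset_circle_of_unitary hu h
  convert hres.smul (Units.mk0 z hz0) using 1
  simp [Algebra.algebraMap_eq_smul_one, Units.smul_def, smul_sub, hz0]

variable {𝕜 H : Type*} [RCLike 𝕜] [NormedAddCommGroup H] [InnerProductSpace 𝕜 H] [CompleteSpace H]

theorem coe_linearIsometryEquiv_mem_unitary (U : H ≃ₗᵢ[𝕜] H) :
    ((U : H ≃L[𝕜] H) : H →L[𝕜] H) ∈ unitary (H →L[𝕜] H) :=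
  (Unitary.linearIsometryEquiv.symm U).2

theorem isUnit_of_add_star_eq_one {X : H →L[𝕜] H} (hX : X + star X = 1) : IsUnit X := by
  refine X.isUnit_of_forall_le_norm_inner_map (c := 1 / 2) (by norm_num) fun x => ?_
  have hre : 2 * RCLike.re (inner 𝕜 (X x) x) = ‖x‖ ^ 2 := by
    have h : X x + star X x = x := congr($hX x)
    calc 2 * RCLike.re (inner 𝕜 (X x) x)
        = RCLike.re (inner 𝕜 (X x) x) + RCLike.re (inner 𝕜 (star X x) x) := by
          rw [ContinuousLinearMap.star_eq_adjoint, ContinuousLinearMap.adjoint_inner_left,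
            inner_re_symm x, two_mul]
      _ = ‖x‖ ^ 2 := by rw [← map_add, ← inner_add_left, h, inner_self_eq_norm_sq]
  have hle := RCLike.re_le_norm (inner 𝕜 (X x) x)
  push_cast
  linarith

theorem bijective_iff_of_isCompl {R M M' : Type*} [Ring R] [AddCommGroup M] [Module R M]
    [AddCommGroup M'] [Module R M'] {p q : Submodule R M} {p' q' : Submodule R M'}
    (h : IsCompl p q) (h' : IsCompl p' q') {T : M →ₗ[R] M'} {a : p → p'} {b : q → q'}
    (ha : ∀ x : p, T x = a x) (hb : ∀ x : q, T x = b x) :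
    Function.Bijective T ↔ Function.Bijective a ∧ Function.Bijective b := by
  have hT : T ∘ Submodule.prodEquivOfIsCompl p q h =
      Submodule.prodEquivOfIsCompl p' q' h' ∘ Prod.map a b := by
    ext ⟨x, y⟩
    simp [ha, hb]
  rw [← Prod.map_bijective, ← Function.Bijective.of_comp_iff T
    (Submodule.prodEquivOfIsCompl p q h).bijective, hT, Function.Bijective.of_comp_iff'
    (Submodule.prodEquivOfIsCompl p' q' h').bijective]

end Operator

namespace ClosedIsometry

variable {H : Type*} [NormedAddCommGroup H] [InnerProductSpace ℂ H] (V : ClosedIsometry H)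

section Geometry

theorem M_zero : V.M 0 = V.domain := by simp [M]

theorem N_zero : V.N 0 = V.domainᗮ := by rw [N, M_zero]

theorem toFun_mem_Minf (x : V.domain) : V.toFun x ∈ V.Minf := ⟨x, rfl⟩

theorem sub_smul_toFun_mem_M (ζ : ℂ) (x : V.domain) : (x : H) - ζ • V.toFun x ∈ V.M ζ :=
  ⟨x, rfl⟩

variable [CompleteSpace H]

theorem isCompl_domain_N_zero : IsCompl V.domain (V.N 0) :=
  V.N_zero ▸ V.domain.isCompl_orthogonal

theorem starProjection_domain_add_N_zero (h : H) :
    V.domain.starProjection h + (V.N 0).starProjection h = h := by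
  simp only [N_zero, Submodule.starProjection_add_starProjection_orthogonal]

theorem orthogonalProjectionOnto_N_zero_eq_zero_iff {h : H} :
    (V.N 0).orthogonalProjectionOnto h = 0 ↔ h ∈ V.domain := by
  rw [Submodule.orthogonalProjectionOnto_eq_zero_iff, N_zero, Submodule.orthogonal_orthogonal]

theorem orthogonalProjectionOnto_domain_of_mem_N_zero {n : H} (hn : n ∈ V.N 0) :
    V.domain.orthogonalProjectionOnto n = 0 := by
  rwa [Submodule.orthogonalProjectionOnto_eq_zero_iff, ← N_zero]

theorem oplus_apply (C : V.N 0 →L[ℂ] V.Ninf) (h : H) :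
    V.oplus C h = V.toFun (V.domain.orthogonalProjectionOnto h) +
      (C ((V.N 0).orthogonalProjectionOnto h) : H) := rfl

theorem oplus_apply_domain (C : V.N 0 →L[ℂ] V.Ninf) (x : V.domain) :
    V.oplus C x = V.toFun x := by
  simp [oplus_apply, V.orthogonalProjectionOnto_N_zero_eq_zero_iff.2 x.2]

theorem oplus_apply_N_zero (C : V.N 0 →L[ℂ] V.Ninf) (n : V.N 0) : V.oplus C n = C n := by
  simp [oplus_apply, V.orthogonalProjectionOnto_domain_of_mem_N_zero n.2]

variable {V} {ζ : ℂ}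

theorem inner_sub_smul_toFun (hζ : ‖ζ‖ = 1) (x : V.domain) (f : H) :
    inner ℂ ((x : H) - ζ • V.toFun x) f = inner ℂ (ζ • V.toFun x)
      (ζ • V.toFun (V.domain.orthogonalProjectionOnto f) - V.Minf.starProjection f) := by
  have hdomain : inner ℂ (x : H) f =
      inner ℂ (ζ • V.toFun x) (ζ • V.toFun (V.domain.orthogonalProjectionOnto f)) :=
    calc inner ℂ (x : H) f
        = inner ℂ x (V.domain.orthogonalProjectionOnto f) :=
          (Submodule.inner_orthogonalProjectionOnto_eq_of_mem_left x f).symm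
      _ = inner ℂ (V.toFun x) (V.toFun (V.domain.orthogonalProjectionOnto f)) :=
          (V.toIsometry.inner_map_map _ _).symm
      _ = _ := by
          rw [inner_smul_left, inner_smul_right, ← mul_assoc, Complex.conj_mul', hζ]
          simp
  have hrange : inner ℂ (ζ • V.toFun x) f = inner ℂ (ζ • V.toFun x) (V.Minf.starProjection f) :=
    (Submodule.inner_orthogonalProjectionOnto_eq_of_mem_left
      (⟨_, V.Minf.smul_mem ζ (V.toFun_mem_Minf x)⟩ : V.Minf) f).symm
  rw [inner_sub_left, hdomain, hrange, inner_sub_right]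

theorem mem_N_iff (hζ : ‖ζ‖ = 1) {f : H} :
    f ∈ V.N ζ ↔
      V.Minf.starProjection f = ζ • V.toFun (V.domain.orthogonalProjectionOnto f) := by
  have hζ0 : ζ ≠ 0 := norm_ne_zero_iff.1 (hζ ▸ one_ne_zero)
  set e := ζ • V.toFun (V.domain.orthogonalProjectionOnto f) - V.Minf.starProjection f with he
  constructor
  · intro hf
    obtain ⟨x, hx⟩ : ζ⁻¹ • e ∈ V.Minf := V.Minf.smul_mem _ <|
      sub_mem (V.Minf.smul_mem _ (V.toFun_mem_Minf _)) (V.Minf.starProjection_apply_mem f)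
    have hxe : ζ • V.toFun x = e := by rw [hx, smul_inv_smul₀ hζ0]
    have hee : inner ℂ e e = 0 := by
      nth_rewrite 1 [← hxe]
      rw [he, ← inner_sub_smul_toFun hζ]
      exact hf _ (V.sub_smul_toFun_mem_M ζ x)
    exact (sub_eq_zero.1 (inner_self_eq_zero.1 hee)).symm
  · rintro hf _ ⟨x, rfl⟩
    refine (inner_sub_smul_toFun hζ x f).trans ?_
    rw [hf, sub_self, inner_zero_right]

theorem eq_zero_of_starProjection_Minf_eq (hζ : ‖ζ‖ = 1)
    (hproj : (V.M ζ).map (V.Minf.starProjection : H →ₗ[ℂ] H) = V.Minf) {x : V.domain}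
    (hx : V.Minf.starProjection (x : H) = ζ • V.toFun x) : x = 0 := by
  have hxN : (x : H) ∈ V.N ζ := by
    rwa [mem_N_iff hζ, Submodule.orthogonalProjectionOnto_mem_subspace_eq_self]
  have hxM : (x : H) ∈ V.Minf := by
    rw [Submodule.mem_iff_norm_starProjection, hx, norm_smul, hζ, one_mul]
    exact V.isometric x
  have horth : (x : H) ∈ V.Minfᗮ := by
    rw [← hproj]
    rintro _ ⟨m, hm, rfl⟩
    calc inner ℂ (V.Minf.starProjection m) (x : H)
        = inner ℂ m (V.Minf.starProjection (x : H)) :=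
          Submodule.inner_starProjection_left_eq_right _ _ _
      _ = inner ℂ m (x : H) := by rw [Submodule.starProjection_eq_self_iff.2 hxM]
      _ = 0 := hxN m hm
  exact Subtype.ext (Submodule.disjoint_def.1 V.Minf.orthogonal_disjoint _ hxM horth)

theorem isCompl_domain_N (hζ : ‖ζ‖ = 1)
    (hproj : (V.M ζ).map (V.Minf.starProjection : H →ₗ[ℂ] H) = V.Minf) :
    IsCompl V.domain (V.N ζ) := by
  constructor
  · refine Submodule.disjoint_def.2 fun x hx hxN => ?_
    refine congrArg Subtype.val (eq_zero_of_starProjection_Minf_eq hζ hproj (x := ⟨x, hx⟩) ?_)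
    rw [(mem_N_iff hζ).1 hxN]
    exact congr(ζ • V.toFun $(Submodule.orthogonalProjectionOnto_mem_subspace_eq_self ⟨x, hx⟩))
  · refine Submodule.codisjoint_iff_exists_add_eq.2 fun h => ?_
    obtain ⟨_, ⟨d, rfl⟩, hd⟩ := hproj.ge <| sub_mem (V.Minf.starProjection_apply_mem h) <|
      V.Minf.smul_mem ζ (V.toFun_mem_Minf (V.domain.orthogonalProjectionOnto h))
    refine ⟨d, h - d, d.2, (mem_N_iff hζ).2 ?_, add_sub_cancel _ _⟩
    have hVd : V.Minf.starProjection (ζ • V.toFun d) = ζ • V.toFun d :=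
      Submodule.starProjection_eq_self_iff.2 (V.Minf.smul_mem _ (V.toFun_mem_Minf d))
    have hd' : V.Minf.starProjection (d : H) - ζ • V.toFun d = V.Minf.starProjection h -
        ζ • V.toFun (V.domain.orthogonalProjectionOnto h) := by
      rw [← hVd, ← map_sub]
      exact hd
    rw [map_sub, map_sub, map_sub, smul_sub,
      Submodule.orthogonalProjectionOnto_mem_subspace_eq_self]
    rw [sub_eq_sub_iff_add_eq_add] at hd' ⊢
    rw [← hd', add_comm]

theorem isCompl_M_Ninf (hζ : ‖ζ‖ = 1)
    (hproj : (V.M ζ).map (V.Minf.starProjection : H →ₗ[ℂ] H) = V.Minf) :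
    IsCompl (V.M ζ) V.Ninf := by
  constructor
  · rw [Submodule.disjoint_def]
    rintro _ ⟨d, rfl⟩ hd
    have hPd : V.Minf.starProjection (d : H) = ζ • V.toFun d := by
      have hzero : V.Minf.starProjection ((d : H) - ζ • V.toFun d) = 0 :=
        (Submodule.starProjection_apply_eq_zero_iff _).2 hd
      rwa [map_sub, Submodule.starProjection_eq_self_iff.2
        (V.Minf.smul_mem _ (V.toFun_mem_Minf d)), sub_eq_zero] at hzero
    rw [eq_zero_of_starProjection_Minf_eq hζ hproj hPd, map_zero]
  · refine Submodule.codisjoint_iff_exists_add_eq.2 fun h => ?_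
    obtain ⟨m, hm, hmh⟩ := hproj.ge (V.Minf.starProjection_apply_mem h)
    refine ⟨m, h - m, hm, (Submodule.starProjection_apply_eq_zero_iff _).1 ?_, add_sub_cancel _ _⟩
    rw [map_sub, sub_eq_zero]
    exact hmh.symm

end Geometry

section BoundaryOperator

variable [CompleteSpace H] {V} {ζ : ℂ}

theorem orthogonalProjectionOnto_mem_domain_W (hζ : ‖ζ‖ = 1) {f : H} (hf : f ∈ V.N ζ) :
    (V.N 0).orthogonalProjectionOnto f ∈ (V.W ζ).domain := by
  refine LinearPMap.mem_domain_of_mem_graph (y := ζ⁻¹ • V.Ninf.orthogonalProjectionOnto f) ?_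
  rw [V.graph_W hζ]
  exact ⟨f, hf, rfl⟩

theorem W_apply (hζ : ‖ζ‖ = 1) {f : H} (hf : f ∈ V.N ζ) :
    V.W ζ ⟨_, orthogonalProjectionOnto_mem_domain_W hζ hf⟩ =
      ζ⁻¹ • V.Ninf.orthogonalProjectionOnto f := by
  refine ((LinearPMap.image_iff _).2 ?_).symm
  rw [V.graph_W hζ]
  exact ⟨f, hf, rfl⟩

theorem exists_of_mem_domain_W (hζ : ‖ζ‖ = 1) {x : V.N 0} (hx : x ∈ (V.W ζ).domain) :
    ∃ f ∈ V.N ζ, (V.N 0).orthogonalProjectionOnto f = x := by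
  have hgraph := (V.W ζ).mem_graph ⟨x, hx⟩
  rw [V.graph_W hζ] at hgraph
  obtain ⟨f, hf, hfx⟩ := hgraph
  exact ⟨f, hf, congrArg Prod.fst hfx⟩

theorem sub_smul_oplus_apply (hζ : ‖ζ‖ = 1) (C : V.N 0 →L[ℂ] V.Ninf) {f : H} (hf : f ∈ V.N ζ) :
    f - ζ • V.oplus C f = (V.Ninf.orthogonalProjectionOnto f -
      ζ • C ((V.N 0).orthogonalProjectionOnto f) : V.Ninf) := by
  have hdecomp : V.Minf.starProjection f + V.Ninf.starProjection f = f :=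
    V.Minf.starProjection_add_starProjection_orthogonal f
  nth_rewrite 1 [← hdecomp]
  rw [(mem_N_iff hζ).1 hf, oplus_apply, smul_add, add_sub_add_left_eq_sub]
  rfl

/-- The block `N_ζ → N_∞` of `E - ζ (V ⊕ C)`, which sends `f ∈ N_ζ` to
`P_{N_∞} f - ζ C P_{N_0} f`. -/
noncomputable def defectBlock (C : V.N 0 →L[ℂ] V.Ninf) (ζ : ℂ) : V.N ζ →ₗ[ℂ] V.Ninf :=
  (V.Ninf.orthogonalProjectionOnto - ζ • C ∘L (V.N 0).orthogonalProjectionOnto :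
    H →L[ℂ] V.Ninf) ∘ₗ (V.N ζ).subtype

theorem defectBlock_eq_smul_toPMap_sub_W (hζ : ‖ζ‖ = 1) (C : V.N 0 →L[ℂ] V.Ninf) (f : V.N ζ) :
    defectBlock C ζ f = -(ζ • ((C : V.N 0 →ₗ[ℂ] V.Ninf).toPMap ⊤ - V.W ζ)
      ⟨_, trivial, orthogonalProjectionOnto_mem_domain_W hζ f.2⟩) := by
  have hζ0 : ζ ≠ 0 := norm_ne_zero_iff.1 (hζ ▸ one_ne_zero)
  rw [LinearPMap.sub_apply, W_apply hζ f.2, smul_sub, smul_inv_smul₀ hζ0, neg_sub]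
  rfl

theorem bijective_defectBlock_iff (hζ : ‖ζ‖ = 1)
    (hproj : (V.M ζ).map (V.Minf.starProjection : H →ₗ[ℂ] H) = V.Minf)
    (C : V.N 0 →L[ℂ] V.Ninf) :
    Function.Bijective (defectBlock C ζ) ↔
      Function.Bijective ((C : V.N 0 →ₗ[ℂ] V.Ninf).toPMap ⊤ - V.W ζ) := by
  have hζ0 : ζ ≠ 0 := norm_ne_zero_iff.1 (hζ ▸ one_ne_zero)
  set S := (C : V.N 0 →ₗ[ℂ] V.Ninf).toPMap ⊤ - V.W ζ
  let e : V.N ζ → S.domain := fun f =>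
    ⟨_, trivial, orthogonalProjectionOnto_mem_domain_W hζ f.2⟩
  have he : Function.Bijective e := by
    refine ⟨fun f g hfg => ?_, fun x => ?_⟩
    · have hdomain : (f - g : H) ∈ V.domain := by
        rw [← orthogonalProjectionOnto_N_zero_eq_zero_iff, map_sub, sub_eq_zero]
        exact congrArg Subtype.val hfg
      exact Subtype.ext <| sub_eq_zero.1 <|
        Submodule.disjoint_def.1 (isCompl_domain_N hζ hproj).disjoint _ hdomain (f - g).2
    · obtain ⟨f, hf, hfx⟩ := exists_of_mem_domain_W hζ x.2.2
      exact ⟨⟨f, hf⟩, Subtype.ext hfx⟩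
  have hscale : Function.Bijective fun y : V.Ninf => -(ζ • y) :=
    (neg_involutive.bijective).comp (MulAction.bijective₀ hζ0)
  have hcomp : ⇑(defectBlock C ζ) = (fun y => -(ζ • y)) ∘ S ∘ e :=
    funext (defectBlock_eq_smul_toPMap_sub_W hζ C)
  rw [hcomp, Function.Bijective.of_comp_iff' hscale, Function.Bijective.of_comp_iff _ he]

theorem bijective_rangeRestrict_domain_sub_smul_toFun (hζ : ‖ζ‖ = 1)
    (hproj : (V.M ζ).map (V.Minf.starProjection : H →ₗ[ℂ] H) = V.Minf) :
    Function.Bijective (V.domain.subtype - ζ • V.toFun).rangeRestrict := by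
  refine ⟨?_, LinearMap.surjective_rangeRestrict _⟩
  rw [← LinearMap.ker_eq_bot, LinearMap.ker_rangeRestrict, LinearMap.ker_eq_bot']
  intro x hx
  have hfix : (x : H) = ζ • V.toFun x := sub_eq_zero.1 hx
  refine eq_zero_of_starProjection_Minf_eq hζ hproj ?_
  rw [hfix]
  exact Submodule.starProjection_eq_self_iff.2 (V.Minf.smul_mem _ (V.toFun_mem_Minf x))

theorem isUnit_one_sub_smul_oplus_iff (hζ : ‖ζ‖ = 1)
    (hproj : (V.M ζ).map (V.Minf.starProjection : H →ₗ[ℂ] H) = V.Minf)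
    (C : V.N 0 →L[ℂ] V.Ninf) :
    IsUnit (1 - ζ • V.oplus C) ↔
      Function.Injective ((C : V.N 0 →ₗ[ℂ] V.Ninf).toPMap ⊤ - V.W ζ) ∧
        Set.range ((C : V.N 0 →ₗ[ℂ] V.Ninf).toPMap ⊤ - V.W ζ) = Set.univ := by
  have hdiagonal := bijective_iff_of_isCompl (isCompl_domain_N hζ hproj) (isCompl_M_Ninf hζ hproj)
    (T := (1 - ζ • V.oplus C : H →L[ℂ] H)) (a := (V.domain.subtype - ζ • V.toFun).rangeRestrict)
    (b := defectBlock C ζ) (fun x => congr((x : H) - ζ • $(V.oplus_apply_domain C x)))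
    (fun f => sub_smul_oplus_apply hζ C f.2)
  rw [ContinuousLinearMap.isUnit_iff_bijective, Set.range_eq_univ]
  exact hdiagonal.trans <|
    (and_iff_right (bijective_rangeRestrict_domain_sub_smul_toFun hζ hproj)).trans
      (bijective_defectBlock_iff hζ hproj C)

end BoundaryOperator

section Oplus

variable {V}

theorem bijective_rangeRestrict_toFun : Function.Bijective V.toFun.rangeRestrict :=
  ⟨fun _ _ hxy => V.toIsometry.injective (congrArg Subtype.val hxy),
    LinearMap.surjective_rangeRestrict _⟩

variable [CompleteSpace H]

theorem bijective_oplus_iff {C : V.N 0 →L[ℂ] V.Ninf} :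
    Function.Bijective (V.oplus C) ↔ Function.Bijective C := by
  have hdiagonal := bijective_iff_of_isCompl V.isCompl_domain_N_zero
    (Submodule.isCompl_orthogonal V.Minf) (T := (V.oplus C : H →ₗ[ℂ] H))
    (a := V.toFun.rangeRestrict) (b := (C : V.N 0 →ₗ[ℂ] V.Ninf)) (V.oplus_apply_domain C)
    (V.oplus_apply_N_zero C)
  exact hdiagonal.trans (and_iff_right bijective_rangeRestrict_toFun)

theorem norm_oplus_apply {C : V.N 0 →L[ℂ] V.Ninf} (hC : ∀ x, ‖C x‖ = ‖x‖) (h : H) :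
    ‖V.oplus C h‖ = ‖h‖ := by
  set d := V.domain.orthogonalProjectionOnto h
  set n := (V.N 0).orthogonalProjectionOnto h
  have hsource : inner ℂ (d : H) (n : H) = 0 := V.N_zero.le n.2 _ d.2
  have htarget : inner ℂ (V.toFun d) (C n : H) = 0 := (C n).2 _ (V.toFun_mem_Minf d)
  refine (mul_self_inj (norm_nonneg _) (norm_nonneg _)).1 ?_
  calc ‖V.oplus C h‖ * ‖V.oplus C h‖
      = ‖V.toFun d‖ * ‖V.toFun d‖ + ‖C n‖ * ‖C n‖ :=
        norm_add_sq_eq_norm_sq_add_norm_sq_of_inner_eq_zero _ _ htarget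
    _ = ‖(d : H)‖ * ‖(d : H)‖ + ‖(n : H)‖ * ‖(n : H)‖ := by
        rw [hC, V.isometric]
        rfl
    _ = ‖(d : H) + n‖ * ‖(d : H) + n‖ :=
        (norm_add_sq_eq_norm_sq_add_norm_sq_of_inner_eq_zero _ _ hsource).symm
    _ = ‖h‖ * ‖h‖ := by
        rw [show (d : H) + n = h from V.starProjection_domain_add_N_zero h]

theorem oplus_mem_unitary_iff {C : V.N 0 →L[ℂ] V.Ninf} :
    V.oplus C ∈ unitary (H →L[ℂ] H) ↔ (∀ x, ‖C x‖ = ‖x‖) ∧ Function.Surjective C := by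
  constructor
  · intro hunitary
    refine ⟨fun x => ?_, ?_⟩
    · have hnorm := ContinuousLinearMap.norm_map_of_mem_unitary hunitary (x : H)
      rwa [oplus_apply_N_zero] at hnorm
    · have hunit : IsUnit (V.oplus C) := (Unitary.toUnits ⟨_, hunitary⟩).isUnit
      exact (bijective_oplus_iff.1 (ContinuousLinearMap.isUnit_iff_bijective.1 hunit)).2
  · rintro ⟨hiso, hsurj⟩
    have hinj : Function.Injective C := (AddMonoidHomClass.isometry_of_norm C hiso).injective
    exact (ContinuousLinearMap.isUnit_iff_bijective.2
      (bijective_oplus_iff.2 ⟨hinj, hsurj⟩)).mem_unitary_of_star_mul_self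
        ((ContinuousLinearMap.norm_map_iff_adjoint_comp_self _).1 (norm_oplus_apply hiso))

variable (V) in
/-- The compression `P_{N_∞} T|_{N_0}` of an operator `T` in `H`; it recovers `C` from `V ⊕ C`. -/
noncomputable def compress (T : H →L[ℂ] H) : V.N 0 →L[ℂ] V.Ninf :=
  V.Ninf.orthogonalProjectionOnto ∘L T ∘L (V.N 0).subtypeL

theorem compress_oplus (C : V.N 0 →L[ℂ] V.Ninf) : V.compress (V.oplus C) = C := by
  ext n
  simp [compress, oplus_apply_N_zero]

theorem continuous_oplus : Continuous V.oplus :=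
  continuous_const.add (continuous_const.clm_comp (continuous_id.clm_comp continuous_const))

theorem continuous_compress : Continuous V.compress :=
  continuous_const.clm_comp (continuous_id.clm_comp continuous_const)

theorem isClosed_range_oplus : IsClosed (Set.range V.oplus) :=
  Function.LeftInverse.isClosed_range (f := V.compress) compress_oplus continuous_compress
    continuous_oplus

end Oplus

section Resolvent

open Filter Topology Metric Set

variable [CompleteSpace H] {V} {R R' : ℂ → H →L[ℂ] H} {C : ℂ → V.N 0 →L[ℂ] V.Ninf} {z ζ : ℂ}

theorem IsGeneralizedResolvent.differentiableAt (hR : V.IsGeneralizedResolvent R) (hz : ‖z‖ ≠ 1) :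
    DifferentiableAt ℂ R z := by
  obtain ⟨K, _, _, _, J, U, -, hRU⟩ := hR
  set u := ((U : K ≃L[ℂ] K) : K →L[ℂ] K)
  have hinverse : DifferentiableAt ℂ (fun z : ℂ => Ring.inverse (1 - z • u)) z :=
    (differentiableAt_inverse (isUnit_one_sub_smul_of_mem_unitary
      (coe_linearIsometryEquiv_mem_unitary U) hz)).comp (f := fun z : ℂ => 1 - z • u) z
        (by fun_prop)
  have hcompress : DifferentiableAt ℂ (fun z : ℂ => J.toContinuousLinearMap.adjoint ∘L
      Ring.inverse (1 - z • u) ∘L J.toContinuousLinearMap) z :=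
    (differentiableAt_const _).clm_comp (hinverse.clm_comp (differentiableAt_const _))
  refine hcompress.congr_of_eventuallyEq ?_
  filter_upwards [continuous_norm.continuousAt.eventually_ne hz] with w hw using hRU w hw

theorem IsGeneralizedResolvent.star_add (hR : V.IsGeneralizedResolvent R) (hz : z ≠ 0)
    (hz1 : ‖z‖ ≠ 1) : star (R z) + R (star z)⁻¹ = 1 := by
  obtain ⟨K, _, _, _, J, U, -, hRU⟩ := hR
  have hw1 : ‖(star z)⁻¹‖ ≠ 1 := by rwa [norm_inv, norm_star, Ne, inv_eq_one]
  have hU := coe_linearIsometryEquiv_mem_unitary U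
  have hsymm := star_ringInverse_one_sub_smul_add hU hz (isUnit_one_sub_smul_of_mem_unitary hU hz1)
  set j := J.toContinuousLinearMap
  rw [hRU z hz1, hRU _ hw1]
  set X := Ring.inverse (1 - z • ((U : K ≃L[ℂ] K) : K →L[ℂ] K))
  set Y := Ring.inverse (1 - (star z)⁻¹ • ((U : K ≃L[ℂ] K) : K →L[ℂ] K))
  calc star (j.adjoint ∘L X ∘L j) + j.adjoint ∘L Y ∘L j
      = j.adjoint ∘L (star X + Y) ∘L j := by
        simp only [ContinuousLinearMap.star_eq_adjoint, ContinuousLinearMap.adjoint_comp,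
          ContinuousLinearMap.adjoint_adjoint, ContinuousLinearMap.comp_assoc,
          ContinuousLinearMap.add_comp, ContinuousLinearMap.comp_add]
    _ = j.adjoint ∘L j := by rw [hsymm]; rfl
    _ = 1 := (ContinuousLinearMap.norm_map_iff_adjoint_comp_self j).1 J.norm_map

theorem IsGeneralizedResolvent.add_star_eq_one (hR : V.IsGeneralizedResolvent R)
    (hRR' : EqOn R' R {z | ‖z‖ < 1 ∨ 1 < ‖z‖}) (hζ : ‖ζ‖ = 1) (hR' : ContinuousAt R' ζ) :
    R' ζ + star (R' ζ) = 1 := by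
  have hζ0 : ζ ≠ 0 := norm_ne_zero_iff.1 (hζ ▸ one_ne_zero)
  have hlimit : Tendsto (fun z => star (R' z) + R' (star z)⁻¹) (𝓝[ball 0 1] ζ)
      (𝓝 (star (R' ζ) + R' ζ)) := by
    have hreflect : Tendsto (fun z : ℂ => (star z)⁻¹) (𝓝 ζ) (𝓝 ζ) := by
      simpa only [inv_star_eq_self hζ] using
        (continuous_star.tendsto ζ).inv₀ (star_ne_zero.2 hζ0)
    exact ((hR'.star.tendsto).add (hR'.tendsto.comp hreflect)).mono_left nhdsWithin_le_nhds
  have hone : (fun z => star (R' z) + R' (star z)⁻¹) =ᶠ[𝓝[ball 0 1] ζ] fun _ => 1 := by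
    filter_upwards [self_mem_nhdsWithin, mem_nhdsWithin_of_mem_nhds (isOpen_ne.mem_nhds hζ0)]
      with z hz hz0
    have hz1 : ‖z‖ < 1 := mem_ball_zero_iff.1 hz
    have hw1 : 1 < ‖(star z)⁻¹‖ := by
      rw [norm_inv, norm_star]
      exact (one_lt_inv₀ (norm_pos_iff.2 hz0)).2 hz1
    rw [hRR' (.inl hz1), hRR' (.inr hw1), hR.star_add hz0 hz1.ne]
  have := neBot_nhdsWithin_ball one_ne_zero (mem_closedBall_zero_iff.2 hζ.le)
  rw [add_comm]
  exact tendsto_nhds_unique_of_eventuallyEq hlimit tendsto_const_nhds hone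

theorem Corresponds.operatorOfResolvent_eq (hRC : V.Corresponds R C) (hz : z ∈ ball 0 1)
    (hz0 : z ≠ 0) (hunit : IsUnit (R z)) : operatorOfResolvent z (R z) = V.oplus (C z) := by
  rw [hRC z hz, isUnit_ringInverse] at hunit
  rw [hRC z hz, operatorOfResolvent_ringInverse hz0 hunit]

theorem Corresponds.eventuallyEq_operatorOfResolvent (hRC : V.Corresponds R C)
    (hRR' : EqOn R' R (ball 0 1)) (hζ0 : ζ ≠ 0) (hR' : ContinuousAt R' ζ)
    (hunit : IsUnit (R' ζ)) :
    (fun z => operatorOfResolvent z (R' z)) =ᶠ[𝓝[ball 0 1] ζ] fun z => V.oplus (C z) := by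
  filter_upwards [self_mem_nhdsWithin, mem_nhdsWithin_of_mem_nhds (isOpen_ne.mem_nhds hζ0),
    mem_nhdsWithin_of_mem_nhds (hR'.eventually_mem (Units.isOpen.mem_nhds hunit))]
    with z hz hz0 hzunit
  have hzunit' : IsUnit (R' z) := hzunit
  rw [hRR' hz] at hzunit' ⊢
  exact hRC.operatorOfResolvent_eq hz hz0 hzunit'

theorem Corresponds.oplus_compress_operatorOfResolvent (hRC : V.Corresponds R C)
    (hRR' : EqOn R' R (ball 0 1)) (hζ : ‖ζ‖ = 1) (hR' : ContinuousAt R' ζ)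
    (hunit : IsUnit (R' ζ)) :
    V.oplus (V.compress (operatorOfResolvent ζ (R' ζ))) = operatorOfResolvent ζ (R' ζ) := by
  have hζ0 : ζ ≠ 0 := norm_ne_zero_iff.1 (hζ ▸ one_ne_zero)
  have hlimit : Tendsto (fun z => operatorOfResolvent z (R' z)) (𝓝[ball 0 1] ζ)
      (𝓝 (operatorOfResolvent ζ (R' ζ))) :=
    ((continuousAt_operatorOfResolvent hζ0 hunit).comp₂ continuousAt_id hR').tendsto.mono_left
      nhdsWithin_le_nhds
  have hmem : ∀ᶠ z in 𝓝[ball 0 1] ζ, operatorOfResolvent z (R' z) ∈ range V.oplus :=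
    (hRC.eventuallyEq_operatorOfResolvent hRR' hζ0 hR' hunit).mono fun z hz => ⟨C z, hz.symm⟩
  have := neBot_nhdsWithin_ball one_ne_zero (mem_closedBall_zero_iff.2 hζ.le)
  obtain ⟨C₀, hC₀⟩ := isClosed_range_oplus.mem_of_tendsto hlimit hmem
  rw [← hC₀, compress_oplus]

end Resolvent

section Extension

open Filter Topology Metric Set

variable [CompleteSpace H] {V} {R R' : ℂ → H →L[ℂ] H} {C : ℂ → V.N 0 →L[ℂ] V.Ninf} {Δ : Set ℂ}

theorem IsGeneralizedResolvent.exists_continuousOn_extension (hR : V.IsGeneralizedResolvent R)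
    (hΔ : Δ ⊆ sphere 0 1) (hC : ContinuousOn C (ball 0 1)) (hRC : V.Corresponds R C)
    (hRR' : EqOn R' R {z | ‖z‖ < 1 ∨ 1 < ‖z‖}) (hR' : ∀ ζ ∈ Δ, ContinuousAt R' ζ) :
    ∃ C' : ℂ → V.N 0 →L[ℂ] V.Ninf, EqOn C' C (ball 0 1) ∧ ContinuousOn C' (ball 0 1 ∪ Δ) ∧
      ∀ ζ ∈ Δ, V.oplus (C' ζ) ∈ unitary (H →L[ℂ] H) ∧ IsUnit (1 - ζ • V.oplus (C' ζ)) := by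
  classical
  have hnorm (ζ) (hζ : ζ ∈ Δ) : ‖ζ‖ = 1 := mem_sphere_zero_iff_norm.1 (hΔ hζ)
  have hne (ζ) (hζ : ζ ∈ Δ) : ζ ≠ 0 := norm_ne_zero_iff.1 (hnorm ζ hζ ▸ one_ne_zero)
  have hball : EqOn R' R (ball 0 1) := fun z hz => hRR' (.inl (mem_ball_zero_iff.1 hz))
  have hadd (ζ) (hζ : ζ ∈ Δ) := hR.add_star_eq_one hRR' (hnorm ζ hζ) (hR' ζ hζ)
  have hunit (ζ) (hζ : ζ ∈ Δ) := isUnit_of_add_star_eq_one (hadd ζ hζ)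
  set T : ℂ → H →L[ℂ] H := fun z => operatorOfResolvent z (R' z)
  have hdisjoint : Disjoint (ball 0 1) Δ := sphere_disjoint_ball.symm.mono_right hΔ
  refine ⟨(ball 0 1).piecewise C fun z => V.compress (T z), piecewise_eqOn _ _ _,
    continuousOn_piecewise_of_eventuallyEq isOpen_ball hdisjoint hC ?_ ?_, ?_⟩
  · intro ζ hζ
    exact continuous_compress.continuousAt.comp
      ((continuousAt_operatorOfResolvent (hne ζ hζ) (hunit ζ hζ)).comp₂ continuousAt_id (hR' ζ hζ))
  · intro ζ hζ
    filter_upwards [hRC.eventuallyEq_operatorOfResolvent hball (hne ζ hζ) (hR' ζ hζ) (hunit ζ hζ)]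
      with z hz
    exact (compress_oplus (C z)).symm.trans congr(V.compress $hz.symm)
  · intro ζ hζ
    have hoplus : V.oplus (V.compress (T ζ)) = T ζ :=
      hRC.oplus_compress_operatorOfResolvent hball (hnorm ζ hζ) (hR' ζ hζ) (hunit ζ hζ)
    rw [piecewise_eq_of_notMem _ _ _ (hdisjoint.notMem_of_mem_right hζ), hoplus]
    refine ⟨operatorOfResolvent_mem_unitary (hnorm ζ hζ) (hunit ζ hζ) (hadd ζ hζ), ?_⟩
    rw [one_sub_smul_operatorOfResolvent (hne ζ hζ)]
    exact isUnit_ringInverse.2 (hunit ζ hζ)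

theorem IsGeneralizedResolvent.exists_analyticOnNhd_extension (hR : V.IsGeneralizedResolvent R)
    (hΔ : Δ ⊆ sphere 0 1) (hopen : IsOpen ({z : ℂ | ‖z‖ < 1 ∨ 1 < ‖z‖} ∪ Δ))
    (hC : ContinuousOn C (ball 0 1 ∪ Δ)) (hRC : V.Corresponds R C)
    (hunitary : ∀ ζ ∈ Δ, V.oplus (C ζ) ∈ unitary (H →L[ℂ] H))
    (hunit : ∀ ζ ∈ Δ, IsUnit (1 - ζ • V.oplus (C ζ))) :
    ∃ R' : ℂ → H →L[ℂ] H, EqOn R' R {z | ‖z‖ < 1 ∨ 1 < ‖z‖} ∧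
      AnalyticOnNhd ℂ R' ({z | ‖z‖ < 1 ∨ 1 < ‖z‖} ∪ Δ) := by
  classical
  set G : ℂ → H →L[ℂ] H := fun z => Ring.inverse (1 - z • V.oplus (C z))
  set R' := (sphere (0 : ℂ) 1).piecewise G R
  have hoff : EqOn R' R {z | ‖z‖ ≠ 1} := fun z hz =>
    piecewise_eq_of_notMem _ _ _ fun h => hz (mem_sphere_zero_iff_norm.1 h)
  have harc : EqOn R' G Δ := (piecewise_eqOn _ _ _).mono hΔ
  have hinside : EqOn R' G (ball 0 1 ∪ Δ) := by
    refine EqOn.union (fun z hz => ?_) harc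
    rw [hoff (mem_ball_zero_iff.1 hz).ne, hRC z hz]
  have hd (z : ℂ) (hz : ‖z‖ ≠ 1) : DifferentiableAt ℂ R' z :=
    (hR.differentiableAt hz).congr_of_eventuallyEq <|
      hoff.eventuallyEq_of_mem ((isOpen_ne_fun continuous_norm continuous_const).mem_nhds hz)
  have hcont : ContinuousOn R' (ball 0 1 ∪ Δ) := by
    rintro z (hz | hz)
    · exact (hd z (mem_ball_zero_iff.1 hz).ne).continuousAt.continuousWithinAt
    · have hdenom : ContinuousWithinAt (fun z => 1 - z • V.oplus (C z)) (ball 0 1 ∪ Δ) z :=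
        continuousWithinAt_const.sub (continuousWithinAt_id.smul
          (continuous_oplus.continuousAt.comp_continuousWithinAt (hC z (.inr hz))))
      have hinverse : ContinuousAt Ring.inverse (1 - z • V.oplus (C z)) :=
        NormedRing.inverse_continuousAt (hunit z hz).unit
      exact (hinverse.comp_continuousWithinAt (f := fun z => 1 - z • V.oplus (C z)) hdenom).congr
        hinside (hinside (.inr hz))
  have hsymm (z) (hz : z ∈ {z : ℂ | 1 < ‖z‖} ∪ Δ) : star (R' (star z)⁻¹) + R' z = 1 := by
    rcases hz with hz | hz
    · have hz' : ‖(star z)⁻¹‖ ≠ 1 := by simpa using hz.ne'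
      have hz0 : (star z)⁻¹ ≠ 0 := by simpa using norm_pos_iff.1 (one_pos.trans hz)
      rw [hoff hz', hoff hz.ne']
      simpa only [star_inv₀, star_star, inv_inv] using hR.star_add hz0 hz'
    · have hz1 : ‖z‖ = 1 := mem_sphere_zero_iff_norm.1 (hΔ hz)
      have h := star_ringInverse_one_sub_smul_add (hunitary z hz)
        (norm_ne_zero_iff.1 (hz1 ▸ one_ne_zero)) (hunit z hz)
      rw [inv_star_eq_self hz1] at h ⊢
      rwa [harc hz]
  exact ⟨R', hoff.mono fun z hz => ne_iff_lt_or_gt.2 hz, analyticOnNhd_of_continuousOn_sides hopen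
    hd hcont (continuousOn_exterior_of_symm hΔ hcont hsymm)⟩

end Extension

end ClosedIsometry

theorem theorem5p3_general {H : Type*} [NormedAddCommGroup H] [InnerProductSpace ℂ H]
    [CompleteSpace H] (V : ClosedIsometry H) (Δ : Set ℂ) (hΔ : Δ ⊆ Metric.sphere 0 1)
    (hopen : IsOpen ({z : ℂ | ‖z‖ < 1 ∨ 1 < ‖z‖} ∪ Δ))
    (hproj : ∀ ζ ∈ Δ, (V.M ζ).map (V.Minf.starProjection : H →ₗ[ℂ] H) = V.Minf)
    (R : ℂ → H →L[ℂ] H) (hR : V.IsGeneralizedResolvent R)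
    (C : ℂ → V.N 0 →L[ℂ] V.Ninf) (hC : ContinuousOn C (Metric.ball 0 1))
    (hRC : V.Corresponds R C) :
    (∃ R' : ℂ → H →L[ℂ] H,
        Set.EqOn R' R {z | ‖z‖ < 1 ∨ 1 < ‖z‖} ∧
        AnalyticOnNhd ℂ R' ({z | ‖z‖ < 1 ∨ 1 < ‖z‖} ∪ Δ)) ↔
      ∃ C' : ℂ → V.N 0 →L[ℂ] V.Ninf,
        Set.EqOn C' C (Metric.ball 0 1) ∧
        ContinuousOn C' (Metric.ball 0 1 ∪ Δ) ∧
        (∀ l ∈ Δ, (∀ x, ‖C' l x‖ = ‖x‖) ∧ Function.Surjective (C' l)) ∧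
        ∀ l ∈ Δ,
          Function.Injective ((C' l : V.N 0 →ₗ[ℂ] V.Ninf).toPMap ⊤ - V.W l) ∧
          Set.range ((C' l : V.N 0 →ₗ[ℂ] V.Ninf).toPMap ⊤ - V.W l) = Set.univ := by
  have hinvertible (ζ) (hζ : ζ ∈ Δ) :=
    ClosedIsometry.isUnit_one_sub_smul_oplus_iff (mem_sphere_zero_iff_norm.1 (hΔ hζ)) (hproj ζ hζ)
  constructor
  · rintro ⟨R', hRR', hanalytic⟩
    obtain ⟨C', hCC', hcont, hboundary⟩ := hR.exists_continuousOn_extension hΔ hC hRC hRR'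
      fun ζ hζ => (hanalytic ζ (.inr hζ)).continuousAt
    exact ⟨C', hCC', hcont,
      fun ζ hζ => ClosedIsometry.oplus_mem_unitary_iff.1 (hboundary ζ hζ).1,
      fun ζ hζ => (hinvertible ζ hζ _).1 (hboundary ζ hζ).2⟩
  · rintro ⟨C', hCC', hcont, hunitary, hbijective⟩
    have hRC' : V.Corresponds R C' := fun z hz => by rw [hCC' hz, hRC z hz]
    exact hR.exists_analyticOnNhd_extension hΔ hopen hcont hRC'
      (fun ζ hζ => ClosedIsometry.oplus_mem_unitary_iff.2 (hunitary ζ hζ))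
      fun ζ hζ => (hinvertible ζ hζ _).2 (hbijective ζ hζ)

theorem theorem5p3 {H : Type*} [NormedAddCommGroup H] [InnerProductSpace ℂ H] [CompleteSpace H]
    (V : ClosedIsometry H) (Δ : Set ℂ) (hΔ : IsOpenArc Δ)
    (hreg : ∀ ζ ∈ Δ, V.IsRegularTypePoint ζ⁻¹)
    (hproj : ∀ ζ ∈ Δ, (V.M ζ).map (V.Minf.starProjection : H →ₗ[ℂ] H) = V.Minf)
    (R : ℂ → H →L[ℂ] H) (hR : V.IsGeneralizedResolvent R)
    (C : ℂ → V.N 0 →L[ℂ] V.Ninf) (hC : C ∈ schurClass (V.N 0) V.Ninf)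
    (hRC : V.Corresponds R C) :
    (∃ R' : ℂ → H →L[ℂ] H,
        Set.EqOn R' R {z | ‖z‖ < 1 ∨ 1 < ‖z‖} ∧
        AnalyticOnNhd ℂ R' ({z | ‖z‖ < 1 ∨ 1 < ‖z‖} ∪ Δ)) ↔
      ∃ C' : ℂ → V.N 0 →L[ℂ] V.Ninf,
        Set.EqOn C' C (Metric.ball 0 1) ∧
        ContinuousOn C' (Metric.ball 0 1 ∪ Δ) ∧
        (∀ l ∈ Δ, (∀ x, ‖C' l x‖ = ‖x‖) ∧ Function.Surjective (C' l)) ∧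
        ∀ l ∈ Δ,
          Function.Injective ((C' l : V.N 0 →ₗ[ℂ] V.Ninf).toPMap ⊤ - V.W l) ∧
          Set.range ((C' l : V.N 0 →ₗ[ℂ] V.Ninf).toPMap ⊤ - V.W l) = Set.univ :=
  theorem5p3_general V Δ hΔ.subset_sphere hΔ.isOpen_union hproj R hR C hC.1.continuousOn hRC
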